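/- For probability measures (equivalently, cumulative distribution functions) $F,G$ on $\mathbb R$ let $d_{CvM}(F,G)=\int_{-\infty}^{\infty}(F(t)-G(t))^2\,G(dt)$. For $a>0$ and a probability measure $H$ on $\mathbb R$, a random probability measure $P$ is a Dirichlet process, $P\sim DP(a,H)$, if for every finite measurable partition $\{A_1,\dots,A_k\}$ of $\mathbb R$ with $k\ge 2$ the vector $(P(A_1),\dots,P(A_k))$ has the $\mathrm{Dirichlet}(aH(A_1),\dots,aH(A_k))$ distribution (coordinates with parameter $0$ being almost surely $0$). **Lemma.** Let $F$ and $G$ be continuous cdf's, let $x_1,x_2,\ldots\overset{i.i.d.}{\sim}F$ and $y_1,y_2,\ldots\overset{i.i.d.}{\sim}G$ be defined on a common probability space, and let $a_1,a_2>0$ and $H_1,H_2$ be probability measures on $\mathbb R$. For each $n_1\ge 0$ let $P_x=P_{x_1,\dots,x_{n_1}}$ be a random probability measure on the same space that is distributed according to the posterior, given $x=(x_1,\dots,x_{n_1})$, of the prior $DP(a_1,H_1)$; that is, conditionally on $x$, $$P_x\sim DP(a_1+n_1,H_x),\qquad H_x=\frac{a_1}{a_1+n_1}H_1+\frac{n_1}{a_1+n_1}F_{n_1},\qquad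 F_{n_1}=\frac1{n_1}\sum_{i=1}^{n_1}\delta_{x_i}$$ (with $H_x=H_1$ if $n_1=0$). Likewise, for each $n_2\ge 0$, let $Q_y=Q_{y_1,\dots,y_{n_2}}$ satisfy $Q_y\sim DP(a_2+n_2,H_y)$ conditionally on $y=(y_1,\dots,y_{n_2})$, where $H_y$ is formed in the same way from $a_2$, $H_2$ and $y$. Nothing further is assumed about the joint distribution of these random measures for different sample sizes, nor about the dependence between the $x$- and the $y$-part. Then, as $n_1,n_2\to\infty$ jointly: 1. if $F=G$, then $d_{CvM}(P_x,Q_y)\to 0$ almost surely; 2. if $F\ne G$, then $\liminf_{n_1,n_2\to\infty} d_{CvM}(P_x,Q_y)>0$ almost surely. -/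

import Mathlib

open MeasureTheory ProbabilityTheory Filter Topology
open scoped ENNReal

noncomputable section

namespace CvMTest

/-- The gamma distribution with shape `α` and rate `1`; for shape `0` it is the point mass at `0`
(the usual degenerate convention in the definition of the Dirichlet distribution). -/
def gammaDist (α : ℝ) : Measure ℝ :=
  if 0 < α then gammaMeasure α 1 else Measure.dirac 0

/-- The Dirichlet distribution with parameters `α₁, …, α_k ≥ 0`, not all zero: the law of
`(Z₁ / ∑ Z_j, …, Z_k / ∑ Z_j)` for independent `Z_i ∼ Gamma(α_i, 1)`.
A coordinate with parameter `0` is almost surely `0`. -/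
def dirichletDist {k : ℕ} (α : Fin k → ℝ) : Measure (Fin k → ℝ) :=
  (Measure.pi fun i => gammaDist (α i)).map fun z i => z i / ∑ j, z j

variable {Ω 𝓧 : Type*} [MeasurableSpace Ω] [MeasurableSpace 𝓧]

/-- The random probability measure `P` is, under `μ`, a Dirichlet process with concentration
parameter `a` and base measure `H`: for every measurable partition `A₁, …, A_k` of the space with
`k ≥ 2`, the vector `(P(A₁), …, P(A_k))` has the Dirichlet distribution with parameters
`(a H(A₁), …, a H(A_k))`. -/
structure IsDirichletProcess (P : Ω → ProbabilityMeasure 𝓧) (a : ℝ) (H : Measure 𝓧)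
    (μ : Measure Ω) : Prop where
  aemeasurable : AEMeasurable P μ
  hasLaw : ∀ (k : ℕ) (A : Fin k → Set 𝓧), 2 ≤ k → (∀ i, MeasurableSet (A i)) →
    (∀ i j, i ≠ j → Disjoint (A i) (A j)) → (⋃ i, A i) = Set.univ →
    HasLaw (fun ω i => (P ω : Measure 𝓧).real (A i)) (dirichletDist fun i => a * H.real (A i)) μ

/-- The empirical measure `n⁻¹ ∑ δ_{x_i}` of a sample (zero for the empty sample). -/
def empiricalMeasure {n : ℕ} (x : Fin n → 𝓧) : Measure 𝓧 :=
  (n : ℝ≥0∞)⁻¹ • ∑ i, Measure.dirac (x i)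

/-- The updated base measure `H_x = a / (a + n) H + n / (a + n) F_n`, where `F_n` is the empirical
measure of the sample `x` of size `n`. -/
def posteriorBase (a : ℝ) (H : Measure 𝓧) {n : ℕ} (x : Fin n → 𝓧) : Measure 𝓧 :=
  ENNReal.ofReal (a / (a + n)) • H + ENNReal.ofReal (n / (a + n)) • empiricalMeasure x

/-- `P n` is distributed according to the posterior of the prior `DP(a, H)` given the first `n`
observations: the conditional distribution of `P n` given `(X 0, …, X (n - 1)) = x` is
`DP(a + n, H_x)`. For `n = 0` this says that `P 0 ∼ DP(a, H)`.
Nothing is prescribed about the joint law of the `P n` for different `n`. -/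
def IsDPPosterior (P : ℕ → Ω → ProbabilityMeasure 𝓧) (a : ℝ) (H : Measure 𝓧) (X : ℕ → Ω → 𝓧)
    (μ : Measure Ω) : Prop :=
  ∀ n : ℕ, ∃ κ : Kernel (Fin n → 𝓧) (ProbabilityMeasure 𝓧), IsMarkovKernel κ ∧
    (∀ x : Fin n → 𝓧, IsDirichletProcess id (a + n) (posteriorBase a H x) (κ x)) ∧
    HasCondDistrib (P n) (fun ω (i : Fin n) => X i ω) κ μ

/-- `X` is an i.i.d. sequence with common law `F`. -/
def IsIIDSample (X : ℕ → Ω → 𝓧) (F : Measure 𝓧) (μ : Measure Ω) : Prop :=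
  (∀ i, HasLaw (X i) F μ) ∧ iIndepFun X μ

/-- The Cramér-von Mises distance `∫ (F(t) - G(t))² G(dt)` of two probability measures on the
real line, identified with their distribution functions. -/
def cvmDist (F G : Measure ℝ) : ℝ := ∫ t, (cdf F t - cdf G t) ^ 2 ∂G

end CvMTest

end

namespace CvMTest

/-! Everything reduces to strong consistency of the posterior on one measurable set `A`. Testing the
Dirichlet process on `{A, Aᶜ}` gives a beta law, whose fourth central moment is of order `(a +
n)⁻²`. With no joint law prescribed across sample sizes, convergence must come from summing moments:
the variance, of order `1/n`, would not be summable, but the fourth moment is. Hence `P n A` minus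
its conditional mean tends to `0` almost surely, and that mean tends to `F A` by the strong law
(`IsDPPosterior.ae_tendsto_real`).

Taking `A = (-∞, r]` for rational `r` gives one null set off which the cdfs converge everywhere. The
rest is deterministic for each `ω`, so the dependence between the two samples is irrelevant and the
joint limit follows by composing with the projections. If `F = G`, Pólya's theorem makes both cdfs
uniformly close to `F`, whatever the moving integrating measure. If `F ≠ G`, continuity of `G`
yields an interval of positive `G`-mass on which monotonicity keeps the two cdfs apart. -/

/-! ### Moments of the gamma distribution. -/

lemma measurable_gammaPDF (a r : ℝ) : Measurable (gammaPDF a r) :=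
  ENNReal.measurable_ofReal.comp (measurable_gammaPDFReal a r)

/-- The moments of the gamma distribution. -/
lemma integrable_pow_gammaMeasure {α : ℝ} (hα : 0 < α) (k : ℕ) :
    Integrable (fun z => z ^ k) (gammaMeasure α 1) ∧
      ∫ z, z ^ k ∂gammaMeasure α 1 = Real.Gamma (α + k) / Real.Gamma α := by
  have hpos : 0 < α + k := by positivity
  have hm := measurable_gammaPDF α 1
  have hlt : ∀ᵐ x ∂(volume : Measure ℝ), gammaPDF α 1 x < ∞ :=
    ae_of_all _ fun x => ENNReal.ofReal_lt_top
  have hfun : (fun x : ℝ => (gammaPDF α 1 x).toReal • x ^ k) = (Set.Ici (0 : ℝ)).indicator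
      fun x => (Real.Gamma α)⁻¹ * (Real.exp (-x) * (x ^ (α - 1) * x ^ k)) := by
    funext x
    rw [gammaPDF, ENNReal.toReal_ofReal (gammaPDFReal_nonneg hα one_pos x)]
    by_cases hx : 0 ≤ x
    · rw [Set.indicator_of_mem (Set.mem_Ici.2 hx), gammaPDFReal, if_pos hx]
      simp only [Real.one_rpow, one_mul, smul_eq_mul]
      ring
    · rw [Set.indicator_of_notMem (by simpa using hx), gammaPDFReal, if_neg hx]
      simp
  -- Restricted to `Ioi 0` because adding exponents needs a positive base; the endpoint is a null
  -- set.
  have hcongr : Set.EqOn (fun x : ℝ => (Real.Gamma α)⁻¹ * (Real.exp (-x) * x ^ (α + k - 1)))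
      (fun x => (Real.Gamma α)⁻¹ * (Real.exp (-x) * (x ^ (α - 1) * x ^ k))) (Set.Ioi 0) := by
    intro x hx
    simp only
    rw [← Real.rpow_natCast x k, ← Real.rpow_add hx]
    ring_nf
  have hint := (Real.GammaIntegral_convergent hpos).const_mul (Real.Gamma α)⁻¹
  constructor
  · rw [gammaMeasure, integrable_withDensity_iff_integrable_smul' hm hlt, hfun,
      integrable_indicator_iff measurableSet_Ici, integrableOn_Ici_iff_integrableOn_Ioi]
    exact IntegrableOn.congr_fun hint hcongr measurableSet_Ioi
  · rw [gammaMeasure, integral_withDensity_eq_integral_toReal_smul hm hlt, hfun,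
      integral_indicator measurableSet_Ici, integral_Ici_eq_integral_Ioi,
      ← setIntegral_congr_fun measurableSet_Ioi hcongr, integral_const_mul,
      ← Real.Gamma_eq_integral hpos, inv_mul_eq_div]

instance isProbabilityMeasure_gammaDist (α : ℝ) : IsProbabilityMeasure (gammaDist α) := by
  unfold gammaDist
  split_ifs with h
  · exact isProbabilityMeasure_gammaMeasure h one_pos
  · infer_instance

lemma ae_nonneg_gammaDist (α : ℝ) : ∀ᵐ z ∂gammaDist α, 0 ≤ z := by
  unfold gammaDist
  split_ifs with h
  · rw [gammaMeasure, ae_withDensity_iff (measurable_gammaPDF α 1)]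
    refine ae_of_all _ fun x hx => ?_
    by_contra hneg
    exact hx (gammaPDF_of_neg (not_le.1 hneg))
  · rw [ae_dirac_eq]
    simp

/-- The fourth central moment of the gamma distribution. -/
lemma lintegral_sub_pow_four_gammaDist {α : ℝ} (hα : 0 ≤ α) :
    ∫⁻ z, ENNReal.ofReal ((z - α) ^ 4) ∂gammaDist α = ENNReal.ofReal (3 * α ^ 2 + 6 * α) := by
  rcases hα.eq_or_lt with rfl | hα
  · simp [gammaDist]
  rw [gammaDist, if_pos hα]
  have : IsProbabilityMeasure (gammaMeasure α 1) := isProbabilityMeasure_gammaMeasure hα one_pos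
  have hG : Real.Gamma α ≠ 0 := (Real.Gamma_pos_of_pos hα).ne'
  have h (k : ℕ) := integrable_pow_gammaMeasure hα k
  have e1 : Real.Gamma (α + 1) = α * Real.Gamma α := Real.Gamma_add_one hα.ne'
  have e2 : Real.Gamma (α + 2) = (α + 1) * (α * Real.Gamma α) := by
    rw [← e1, ← Real.Gamma_add_one (by positivity)]; ring_nf
  have e3 : Real.Gamma (α + 3) = (α + 2) * ((α + 1) * (α * Real.Gamma α)) := by
    rw [← e2, ← Real.Gamma_add_one (by positivity)]; ring_nf
  have e4 : Real.Gamma (α + 4) = (α + 3) * ((α + 2) * ((α + 1) * (α * Real.Gamma α))) := by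
    rw [← e3, ← Real.Gamma_add_one (by positivity)]; ring_nf
  have i4 := (h 4).1
  have i3 := (h 3).1.const_mul (4 * α)
  have i2 := (h 2).1.const_mul (6 * α ^ 2)
  have i1 := (h 1).1.const_mul (4 * α ^ 3)
  have i0 := integrable_const (μ := gammaMeasure α 1) (α ^ 4)
  have hexp : (fun z : ℝ => (z - α) ^ 4) = fun z => z ^ 4 - 4 * α * z ^ 3 + 6 * α ^ 2 * z ^ 2
      - 4 * α ^ 3 * z ^ 1 + α ^ 4 := by
    funext z; ring
  have j3 : Integrable (fun z => z ^ 4 - 4 * α * z ^ 3) (gammaMeasure α 1) := i4.sub i3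
  have j2 : Integrable (fun z => z ^ 4 - 4 * α * z ^ 3 + 6 * α ^ 2 * z ^ 2) (gammaMeasure α 1) :=
    j3.add i2
  have j1 : Integrable (fun z => z ^ 4 - 4 * α * z ^ 3 + 6 * α ^ 2 * z ^ 2 - 4 * α ^ 3 * z ^ 1)
    (gammaMeasure α 1) := j2.sub i1
  have hint : Integrable (fun z : ℝ => (z - α) ^ 4) (gammaMeasure α 1) := by
    rw [hexp]
    exact j1.add i0
  rw [← ofReal_integral_eq_lintegral_ofReal hint (ae_of_all _ fun z => by positivity), hexp,
    integral_add j1 i0, integral_sub j2 i1, integral_add j3 i2, integral_sub i4 i3]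
  simp only [integral_const_mul, (h _).2, integral_const, probReal_univ, one_smul]
  push_cast
  rw [e1, e2, e3, e4]
  congr 1
  field_simp
  ring

/-! ### Fourth moments: from gamma variables to Dirichlet processes. -/

/-- If `x + y` is at most half of `α + β`, the deviations already sum to at least `(α + β) / 2`, so
the trivial bound `1` suffices; this covers `x + y = 0`, where the quotient is `0` by convention.
Otherwise the common denominator is at least `(α + β)² / 2`. -/
lemma abs_div_add_sub_div_add_le {x y α β : ℝ} (hx : 0 ≤ x) (hy : 0 ≤ y) (hα : 0 ≤ α)
    (hβ : 0 ≤ β) (hs : 0 < α + β) :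
    |x / (x + y) - α / (α + β)| ≤ 2 / (α + β) * (|x - α| + |y - β|) := by
  have hbound : |x / (x + y) - α / (α + β)| ≤ 1 := by
    have h1 : x / (x + y) ≤ 1 := div_le_one_of_le₀ (by linarith) (by positivity)
    have h2 : α / (α + β) ≤ 1 := div_le_one_of_le₀ (by linarith) hs.le
    have h3 : 0 ≤ x / (x + y) := by positivity
    have h4 : 0 ≤ α / (α + β) := by positivity
    rw [abs_le]; constructor <;> linarith
  have t1 : α - x ≤ |x - α| := by rw [abs_sub_comm]; exact le_abs_self _
  have t2 : β - y ≤ |y - β| := by rw [abs_sub_comm]; exact le_abs_self _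
  rcases le_or_gt (x + y) ((α + β) / 2) with h | h
  · refine hbound.trans ?_
    rw [div_mul_eq_mul_div, le_div_iff₀ hs]
    linarith
  · have hxy : 0 < x + y := by linarith
    have hnum : x / (x + y) - α / (α + β)
        = (β * (x - α) - α * (y - β)) / ((x + y) * (α + β)) := by
      field_simp; ring
    rw [hnum, abs_div, abs_of_pos (mul_pos hxy hs), div_mul_eq_mul_div,
      div_le_div_iff₀ (mul_pos hxy hs) hs]
    have hn : |β * (x - α) - α * (y - β)| ≤ (α + β) * (|x - α| + |y - β|) := by
      refine (abs_sub _ _).trans ?_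
      rw [abs_mul, abs_mul, abs_of_nonneg hα, abs_of_nonneg hβ]
      nlinarith [mul_nonneg hα (abs_nonneg (x - α)), mul_nonneg hβ (abs_nonneg (y - β))]
    calc |β * (x - α) - α * (y - β)| * (α + β)
        ≤ ((α + β) * (|x - α| + |y - β|)) * (α + β) := by gcongr
      _ = (2 * (|x - α| + |y - β|)) * ((α + β) / 2 * (α + β)) := by ring
      _ ≤ (2 * (|x - α| + |y - β|)) * ((x + y) * (α + β)) := by gcongr

/-- The constant is `2⁴ · 2³`: the factor `2` of the linear bound to the fourth power, and `2³` from
convexity of the fourth power. -/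
lemma div_add_sub_div_add_pow_four_le {x y α β : ℝ} (hx : 0 ≤ x) (hy : 0 ≤ y) (hα : 0 ≤ α)
    (hβ : 0 ≤ β) (hs : 0 < α + β) :
    (x / (x + y) - α / (α + β)) ^ 4
      ≤ 128 / (α + β) ^ 4 * ((x - α) ^ 4 + (y - β) ^ 4) := by
  have h := pow_le_pow_left₀ (abs_nonneg _) (abs_div_add_sub_div_add_le hx hy hα hβ hs) 4
  rw [(by decide : Even 4).pow_abs] at h
  refine h.trans ?_
  have h8 : (|x - α| + |y - β|) ^ 4 ≤ 8 * ((x - α) ^ 4 + (y - β) ^ 4) := by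
    have := add_pow_le (abs_nonneg (x - α)) (abs_nonneg (y - β)) 4
    rw [(by decide : Even 4).pow_abs, (by decide : Even 4).pow_abs] at this
    norm_num at this
    linarith
  calc (2 / (α + β) * (|x - α| + |y - β|)) ^ 4
      = 16 / (α + β) ^ 4 * (|x - α| + |y - β|) ^ 4 := by rw [mul_pow, div_pow]; norm_num
    _ ≤ 16 / (α + β) ^ 4 * (8 * ((x - α) ^ 4 + (y - β) ^ 4)) := by gcongr
    _ = _ := by ring

/-- A bound for the fourth central moment of the beta distribution. -/
lemma lintegral_sub_pow_four_dirichletDist_le (α : Fin 2 → ℝ) (hα : ∀ i, 0 ≤ α i)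
    (hs : 0 < α 0 + α 1) :
    ∫⁻ v, ENNReal.ofReal ((v 0 - α 0 / (α 0 + α 1)) ^ 4) ∂dirichletDist α
      ≤ ENNReal.ofReal (128 / (α 0 + α 1) ^ 4 * (3 * (α 0 + α 1) ^ 2 + 6 * (α 0 + α 1))) := by
  set s := α 0 + α 1
  have hmarg (i : Fin 2) : ∫⁻ z, ENNReal.ofReal ((z i - α i) ^ 4)
      ∂(Measure.pi fun i => gammaDist (α i)) = ENNReal.ofReal (3 * α i ^ 2 + 6 * α i) := by
    rw [← lintegral_sub_pow_four_gammaDist (hα i)]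
    exact (measurePreserving_eval (fun i => gammaDist (α i)) i).lintegral_comp
      (f := fun z => ENNReal.ofReal ((z - α i) ^ 4)) (by fun_prop)
  have hpos : ∀ᵐ z ∂(Measure.pi fun i => gammaDist (α i)), ∀ i, 0 ≤ z i :=
    ae_all_iff.2 fun i => (measurePreserving_eval (fun i => gammaDist (α i))
      i).quasiMeasurePreserving.ae (ae_nonneg_gammaDist (α i))
  rw [dirichletDist, lintegral_map (by fun_prop) (by fun_prop)]
  calc ∫⁻ z, ENNReal.ofReal ((z 0 / ∑ j, z j - α 0 / s) ^ 4) ∂(Measure.pi fun i => gammaDist (α i))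
      ≤ ∫⁻ z, ENNReal.ofReal (128 / s ^ 4) * (ENNReal.ofReal ((z 0 - α 0) ^ 4)
          + ENNReal.ofReal ((z 1 - α 1) ^ 4)) ∂(Measure.pi fun i => gammaDist (α i)) := by
        refine lintegral_mono_ae (hpos.mono fun z hz => ?_)
        rw [← ENNReal.ofReal_add (by positivity) (by positivity),
          ← ENNReal.ofReal_mul (by positivity), Fin.sum_univ_two]
        exact ENNReal.ofReal_le_ofReal
          (div_add_sub_div_add_pow_four_le (hz 0) (hz 1) (hα 0) (hα 1) hs)
    _ = ENNReal.ofReal (128 / s ^ 4 * ((3 * α 0 ^ 2 + 6 * α 0) + (3 * α 1 ^ 2 + 6 * α 1))) := by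
        have h0 := hα 0
        have h1 := hα 1
        rw [lintegral_const_mul _ (by fun_prop), lintegral_add_left (by fun_prop), hmarg, hmarg,
          ← ENNReal.ofReal_add (by positivity) (by positivity),
          ← ENNReal.ofReal_mul (by positivity)]
    _ ≤ _ := by
        refine ENNReal.ofReal_le_ofReal (mul_le_mul_of_nonneg_left ?_ (by positivity))
        have := mul_nonneg (hα 0) (hα 1)
        simp only [s]
        nlinarith

variable {Ω 𝓧 : Type*} [MeasurableSpace Ω] [MeasurableSpace 𝓧]

/-- The mean of a Dirichlet process is its base measure, and its fourth central moments decay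
quadratically in the concentration parameter. -/
lemma IsDirichletProcess.lintegral_sub_pow_four_le {P : Ω → ProbabilityMeasure 𝓧} {a : ℝ}
    {H : Measure 𝓧} [IsProbabilityMeasure H] {μ : Measure Ω} (h : IsDirichletProcess P a H μ)
    (ha : 0 < a) {A : Set 𝓧} (hA : MeasurableSet A) :
    ∫⁻ ω, ENNReal.ofReal (((P ω : Measure 𝓧).real A - H.real A) ^ 4) ∂μ
      ≤ ENNReal.ofReal (128 / a ^ 4 * (3 * a ^ 2 + 6 * a)) := by
  have hlaw := h.hasLaw 2 ![A, Aᶜ] le_rfl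
    (fun i => by fin_cases i <;> simp [hA, hA.compl])
    (fun i j hij => by
      fin_cases i <;> fin_cases j <;> simp_all [disjoint_compl_right, disjoint_compl_left])
    (by ext x; simp [Fin.exists_fin_two, em])
  have hsum : H.real A + H.real Aᶜ = 1 := by
    rw [measureReal_add_measureReal_compl hA, probReal_univ]
  have hs : a * H.real A + a * H.real Aᶜ = a := by rw [← mul_add, hsum, mul_one]
  have key := lintegral_sub_pow_four_dirichletDist_le
    (fun i => a * H.real ((![A, Aᶜ] : Fin 2 → Set 𝓧) i))
    (fun i => mul_nonneg ha.le measureReal_nonneg) (by simpa [hs] using ha)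
  rw [← hlaw.map_eq, lintegral_map' (Measurable.aemeasurable (by fun_prop)) hlaw.aemeasurable]
    at key
  simpa [hs, mul_div_cancel_left₀ _ ha.ne'] using key

/-! ### The posterior base measure and the posterior moment bound. -/

lemma posteriorBase_apply {a : ℝ} (H : Measure 𝓧) {n : ℕ} (x : Fin n → 𝓧) {A : Set 𝓧}
    (hA : MeasurableSet A) :
    posteriorBase a H x A = ENNReal.ofReal (a / (a + n)) * H A
      + ENNReal.ofReal (n / (a + n)) * ((n : ℝ≥0∞)⁻¹ * ∑ i, A.indicator 1 (x i)) := by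
  simp [posteriorBase, empiricalMeasure, Measure.dirac_apply' _ hA]

lemma measurable_posteriorBase_real (a : ℝ) (H : Measure 𝓧) (n : ℕ) {A : Set 𝓧}
    (hA : MeasurableSet A) :
    Measurable fun x : Fin n → 𝓧 => (posteriorBase a H x).real A := by
  simp only [measureReal_def, posteriorBase_apply H _ hA]
  have h (i : Fin n) : Measurable fun x : Fin n → 𝓧 => A.indicator (1 : 𝓧 → ℝ≥0∞) (x i) :=
    (measurable_one.indicator hA).comp (measurable_pi_apply i)
  fun_prop

lemma isProbabilityMeasure_posteriorBase {a : ℝ} (ha : 0 < a) (H : Measure 𝓧)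
    [IsProbabilityMeasure H] {n : ℕ} (x : Fin n → 𝓧) :
    IsProbabilityMeasure (posteriorBase a H x) := by
  constructor
  rw [posteriorBase_apply H x MeasurableSet.univ]
  -- For `n = 0` the factor `n⁻¹` is `∞`, but it multiplies an empty sum.
  rcases Nat.eq_zero_or_pos n with rfl | hn
  · simp [div_self ha.ne']
  · have hn' : (n : ℝ≥0∞) ≠ 0 := by exact_mod_cast hn.ne'
    simp only [measure_univ, mul_one, Set.indicator_univ, Pi.one_apply, Finset.sum_const,
      Finset.card_univ, Fintype.card_fin, nsmul_eq_mul,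
      ENNReal.inv_mul_cancel hn' (ENNReal.natCast_ne_top n)]
    rw [← ENNReal.ofReal_add (by positivity) (by positivity), ← add_div,
      div_self (by positivity), ENNReal.ofReal_one]

lemma posteriorBase_real {a : ℝ} (ha : 0 < a) (H : Measure 𝓧) [IsProbabilityMeasure H] {n : ℕ}
    (x : Fin n → 𝓧) {A : Set 𝓧} (hA : MeasurableSet A) :
    (posteriorBase a H x).real A = a / (a + n) * H.real A
      + n / (a + n) * ((∑ i, A.indicator 1 (x i)) / n) := by
  have hind (y : 𝓧) : (A.indicator (1 : 𝓧 → ℝ≥0∞) y) ≠ ∞ := by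
    by_cases hy : y ∈ A <;> simp [hy]
  have hreal (y : 𝓧) : (A.indicator (1 : 𝓧 → ℝ≥0∞) y).toReal = A.indicator (1 : 𝓧 → ℝ) y := by
    by_cases hy : y ∈ A <;> simp [hy]
  rcases Nat.eq_zero_or_pos n with rfl | hn
  · simp [measureReal_def, posteriorBase_apply H x hA, div_self ha.ne']
  have hn' : (n : ℝ≥0∞) ≠ 0 := by exact_mod_cast hn.ne'
  have hS : ∑ i, A.indicator (1 : 𝓧 → ℝ≥0∞) (x i) ≠ ∞ := ENNReal.sum_ne_top.2 fun i _ => hind _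
  rw [measureReal_def, posteriorBase_apply H x hA, ENNReal.toReal_add
    (ENNReal.mul_ne_top ENNReal.ofReal_ne_top (measure_ne_top H A))
    (ENNReal.mul_ne_top ENNReal.ofReal_ne_top
      (ENNReal.mul_ne_top (ENNReal.inv_ne_top.2 hn') hS)),
    ENNReal.toReal_mul, ENNReal.toReal_mul, ENNReal.toReal_mul, ENNReal.toReal_inv,
    ENNReal.toReal_natCast, ENNReal.toReal_sum fun i _ => hind _,
    ENNReal.toReal_ofReal (by positivity), ENNReal.toReal_ofReal (by positivity), measureReal_def]
  simp only [hreal, div_eq_inv_mul _ (n : ℝ)]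

lemma measurable_probabilityMeasure_real {A : Set 𝓧} (hA : MeasurableSet A) :
    Measurable fun p : ProbabilityMeasure 𝓧 => (p : Measure 𝓧).real A :=
  ((Measure.measurable_coe hA).comp measurable_subtype_coe).ennreal_toReal

variable {μ : Measure Ω}

/-- Disintegrating the joint law along `κ` freezes the sample, and the Dirichlet process bound does
not depend on its value. -/
lemma lintegral_posterior_sub_pow_four_le [SFinite μ] {a : ℝ} (ha : 0 < a) (H : Measure 𝓧)
    [IsProbabilityMeasure H] {n : ℕ} {Z : Ω → Fin n → 𝓧} {p : Ω → ProbabilityMeasure 𝓧}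
    {κ : Kernel (Fin n → 𝓧) (ProbabilityMeasure 𝓧)} [IsMarkovKernel κ]
    (hκ : ∀ x, IsDirichletProcess id (a + n) (posteriorBase a H x) (κ x))
    (h : HasCondDistrib p Z κ μ) {A : Set 𝓧} (hA : MeasurableSet A) :
    ∫⁻ ω, ENNReal.ofReal (((p ω : Measure 𝓧).real A - (posteriorBase a H (Z ω)).real A) ^ 4) ∂μ
      ≤ ENNReal.ofReal (128 / (a + n) ^ 4 * (3 * (a + n) ^ 2 + 6 * (a + n))) * μ Set.univ := by
  have hm : Measurable fun q : (Fin n → 𝓧) × ProbabilityMeasure 𝓧 =>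
      ENNReal.ofReal (((q.2 : Measure 𝓧).real A - (posteriorBase a H q.1).real A) ^ 4) :=
    ((((measurable_probabilityMeasure_real hA).comp measurable_snd).sub
      ((measurable_posteriorBase_real a H n hA).comp measurable_fst)).pow_const 4).ennreal_ofReal
  have heq := lintegral_map' hm.aemeasurable h.aemeasurable
  rw [h.map_eq, Measure.lintegral_compProd hm] at heq
  rw [← heq]
  calc _ ≤ ∫⁻ _, ENNReal.ofReal (128 / (a + n) ^ 4 * (3 * (a + n) ^ 2 + 6 * (a + n)))
        ∂(μ.map Z) := lintegral_mono fun x => by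
          have := isProbabilityMeasure_posteriorBase ha H x
          exact (hκ x).lintegral_sub_pow_four_le (by positivity) hA
    _ = _ := by
      rw [lintegral_const, Measure.map_apply_of_aemeasurable h.aemeasurable_fst MeasurableSet.univ,
        Set.preimage_univ]

lemma moment_bound_le {a : ℝ} (ha : 0 < a) {n : ℕ} (hn : 0 < n) :
    128 / (a + n) ^ 4 * (3 * (a + n) ^ 2 + 6 * (a + n)) ≤ (384 + 768 / a) * (1 / (n : ℝ) ^ 2) := by
  have hn' : (0 : ℝ) < n := by exact_mod_cast hn
  have hs : 0 < a + n := by positivity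
  calc 128 / (a + n) ^ 4 * (3 * (a + n) ^ 2 + 6 * (a + n))
      = (384 + 768 / (a + n)) * (1 / (a + n) ^ 2) := by field_simp; ring
    _ ≤ (384 + 768 / a) * (1 / (n : ℝ) ^ 2) := by gcongr <;> linarith

/-! ### Strong consistency on a fixed set. -/

/-- The empirical frequency of a measurable set converges almost surely to its probability. -/
lemma IsIIDSample.ae_tendsto_frequency {F : Measure 𝓧} [IsProbabilityMeasure F] {X : ℕ → Ω → 𝓧}
    (hX : IsIIDSample X F μ) {A : Set 𝓧} (hA : MeasurableSet A) :
    ∀ᵐ ω ∂μ, Tendsto (fun n : ℕ => (∑ i : Fin n, A.indicator (1 : 𝓧 → ℝ) (X i ω)) / n) atTop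
      (𝓝 (F.real A)) := by
  have hμ : IsProbabilityMeasure μ := (hX.1 0).isProbabilityMeasure
  have hg : Measurable (A.indicator (1 : 𝓧 → ℝ)) := measurable_one.indicator hA
  have hid (i : ℕ) : IdentDistrib (X i) (X 0) μ μ :=
    ⟨(hX.1 i).aemeasurable, (hX.1 0).aemeasurable, by rw [(hX.1 i).map_eq, (hX.1 0).map_eq]⟩
  have hint : Integrable (fun ω => A.indicator (1 : 𝓧 → ℝ) (X 0 ω)) μ := by
    refine Integrable.of_bound
      (hg.comp_aemeasurable (hX.1 0).aemeasurable).aestronglyMeasurable 1 (ae_of_all _ fun ω => ?_)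
    by_cases h : X 0 ω ∈ A <;> simp [h]
  have hmean : ∫ ω, A.indicator (1 : 𝓧 → ℝ) (X 0 ω) ∂μ = F.real A := by
    rw [← integral_map (hX.1 0).aemeasurable hg.aestronglyMeasurable, (hX.1 0).map_eq,
      integral_indicator_one hA]
  have h := strong_law_ae_real (fun i ω => A.indicator (1 : 𝓧 → ℝ) (X i ω)) hint
    (fun i j hij => (hX.2.indepFun hij).comp hg hg) (fun i => (hid i).comp hg)
  filter_upwards [h] with ω hω
  rw [hmean] at hω
  exact hω.congr fun n => by
    rw [Finset.sum_range fun i => A.indicator (1 : 𝓧 → ℝ) (X i ω)]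

/-- The posterior probability of a measurable set is strongly consistent. -/
lemma IsDPPosterior.ae_tendsto_real [IsProbabilityMeasure μ] {F H : Measure 𝓧}
    [IsProbabilityMeasure F] [IsProbabilityMeasure H] {a : ℝ} (ha : 0 < a) {X : ℕ → Ω → 𝓧}
    (hX : IsIIDSample X F μ) {P : ℕ → Ω → ProbabilityMeasure 𝓧} (hP : IsDPPosterior P a H X μ)
    {A : Set 𝓧} (hA : MeasurableSet A) :
    ∀ᵐ ω ∂μ, Tendsto (fun n => (P n ω : Measure 𝓧).real A) atTop (𝓝 (F.real A)) := by
  set D : ℕ → Ω → ℝ := fun n ω =>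
    (P n ω : Measure 𝓧).real A - (posteriorBase a H fun i : Fin n => X i ω).real A with hD
  have hDm (n : ℕ) : AEMeasurable (fun ω => ENNReal.ofReal (D n ω ^ 4)) μ := by
    obtain ⟨κ, _, -, hc⟩ := hP n
    exact ((((measurable_probabilityMeasure_real hA).comp_aemeasurable hc.aemeasurable_snd).sub
      ((measurable_posteriorBase_real a H n hA).comp_aemeasurable
        hc.aemeasurable_fst)).pow_const 4).ennreal_ofReal
  -- Shifted by one: at sample size `0` the bound `1 / n ^ 2` would be `0` by convention.
  have hDle (n : ℕ) : ∫⁻ ω, ENNReal.ofReal (D (n + 1) ω ^ 4) ∂μ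
      ≤ ENNReal.ofReal ((384 + 768 / a) * (1 / ((n + 1 : ℕ) : ℝ) ^ 2)) := by
    obtain ⟨κ, _, hκ, hc⟩ := hP (n + 1)
    refine (lintegral_posterior_sub_pow_four_le ha H hκ hc hA).trans ?_
    rw [measure_univ, mul_one]
    exact ENNReal.ofReal_le_ofReal (moment_bound_le ha n.succ_pos)
  have hsum : ∫⁻ ω, ∑' n, ENNReal.ofReal (D (n + 1) ω ^ 4) ∂μ ≠ ∞ := by
    rw [lintegral_tsum fun n => hDm (n + 1)]
    refine ne_top_of_le_ne_top ?_ (ENNReal.tsum_le_tsum hDle)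
    have hs : Summable fun n : ℕ => (384 + 768 / a) * (1 / ((n + 1 : ℕ) : ℝ) ^ 2) :=
      ((summable_nat_add_iff 1).2 (Real.summable_one_div_nat_pow.2 one_lt_two)).mul_left _
    exact hs.tsum_ofReal_ne_top
  filter_upwards [ae_lt_top' (AEMeasurable.tsum fun n => hDm (n + 1)) hsum,
    hX.ae_tendsto_frequency hA] with ω hω hfreq
  have h4 : Tendsto (fun n => D n ω ^ 4) atTop (𝓝 0) := by
    have h := ENNReal.tendsto_atTop_zero_of_tsum_ne_top hω.ne
    have h' := (ENNReal.tendsto_toReal ENNReal.zero_ne_top).comp h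
    rw [← tendsto_add_atTop_iff_nat 1]
    refine h'.congr fun n => ?_
    exact ENNReal.toReal_ofReal ((by decide : Even 4).pow_nonneg _)
  have h0 : Tendsto (fun n => D n ω) atTop (𝓝 0) := by
    have h := h4.sqrt.sqrt
    rw [Real.sqrt_zero, Real.sqrt_zero] at h
    refine (tendsto_zero_iff_abs_tendsto_zero _).2 (h.congr fun n => ?_)
    rw [show D n ω ^ 4 = (D n ω ^ 2) ^ 2 by ring, Real.sqrt_sq (sq_nonneg _), Real.sqrt_sq_eq_abs]
    rfl
  have hinf : Tendsto (fun n : ℕ => a + n) atTop atTop :=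
    tendsto_atTop_add_const_left _ _ tendsto_natCast_atTop_atTop
  have hw1 : Tendsto (fun n : ℕ => a / (a + n)) atTop (𝓝 0) := hinf.const_div_atTop a
  have hw2 : Tendsto (fun n : ℕ => n / (a + n)) atTop (𝓝 1) := by
    have h := hw1.const_sub 1
    rw [sub_zero] at h
    refine h.congr fun n => ?_
    have : a + n ≠ 0 := by positivity
    field_simp
    ring
  have hbase : Tendsto (fun n => (posteriorBase a H fun i : Fin n => X i ω).real A) atTop
      (𝓝 (F.real A)) := by
    have h := (hw1.mul_const (H.real A)).add (hw2.mul hfreq)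
    rw [zero_mul, one_mul, zero_add] at h
    exact h.congr fun n => (posteriorBase_real ha H _ hA).symm
  have h := h0.add hbase
  rw [zero_add] at h
  exact h.congr fun n => sub_add_cancel _ _

/-! ### Convergence of distribution functions. -/

/-- Pólya's theorem: distribution functions that
converge pointwise to a continuous distribution function converge uniformly. -/
lemma tendstoUniformly_of_tendsto_cdf {F : Measure ℝ} (hF : Continuous (cdf F))
    {ι : Type*} {l : Filter ι} {p : ι → Measure ℝ}
    (h : ∀ t, Tendsto (fun i => cdf (p i) t) l (𝓝 (cdf F t))) :
    TendstoUniformly (fun i t => cdf (p i) t) (cdf F) l := by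
  rw [Metric.tendstoUniformly_iff]
  intro ε hε
  -- Grid error `1 / N` and convergence error at the grid points each take `ε / 2`. Only levels
  -- strictly between `0` and `1` are used, since the extremes need not be attained.
  obtain ⟨N, hN⟩ := exists_nat_gt (2 / ε)
  have hN0 : (0 : ℝ) < N := lt_trans (by positivity) hN
  have hNε : 1 / (N : ℝ) < ε / 2 := by
    rw [div_lt_iff₀ hε] at hN
    rw [div_lt_div_iff₀ hN0 two_pos]
    linarith
  have hlevel (k : ℕ) (hk : 0 < k ∧ k < N) : ∃ t, cdf F t = k / N := by
    have h1 : 0 < (k : ℝ) / N := div_pos (by exact_mod_cast hk.1) hN0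
    have h2 : (k : ℝ) / N < 1 := (div_lt_one hN0).2 (by exact_mod_cast hk.2)
    obtain ⟨u, hu⟩ := ((tendsto_cdf_atBot F).eventually_lt_const h1).exists
    obtain ⟨v, hv⟩ := ((tendsto_cdf_atTop F).eventually_const_lt h2).exists
    exact mem_range_of_exists_le_of_exists_ge hF ⟨u, hu.le⟩ ⟨v, hv.le⟩
  choose! q hq using hlevel
  have hev : ∀ᶠ i in l, ∀ k ∈ Finset.range N, |cdf (p i) (q k) - cdf F (q k)| < ε / 2 := by
    rw [Filter.eventually_all_finset]
    intro k _
    have := Metric.tendsto_nhds.1 (h (q k)) (ε / 2) (half_pos hε)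
    simpa only [Real.dist_eq] using this
  filter_upwards [hev] with i hi t
  have hFt0 := cdf_nonneg F t
  have hFt1 := cdf_le_one F t
  have hp0 := cdf_nonneg (p i) t
  have hp1 := cdf_le_one (p i) t
  have hNε2 : 2 < ε * N := by rwa [div_lt_iff₀ hε, mul_comm] at hN
  rw [dist_comm, Real.dist_eq, abs_lt]
  constructor
  · rcases lt_or_ge (cdf F t) ε with hlt | hge
    · linarith
    have hFN : 2 < cdf F t * N := hNε2.trans_le (by gcongr)
    -- `k / N` is the largest level strictly below `cdf F t`; strictness places `q k` to the left of
    -- `t`.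
    obtain ⟨k, hk⟩ : ∃ k, ⌈cdf F t * N⌉₊ = k + 1 :=
      Nat.exists_eq_succ_of_ne_zero (Nat.ceil_pos.2 (by linarith)).ne'
    have hk1 : cdf F t * N ≤ k + 1 := by
      have := Nat.le_ceil (cdf F t * N)
      rw [hk] at this
      exact_mod_cast this
    have hk2 : (k : ℝ) < cdf F t * N := Nat.lt_ceil.1 (by omega)
    have hk0 : 0 < k := by
      have : (0 : ℝ) < k := by linarith
      exact_mod_cast this
    have hkN : k < N := by
      have : (k : ℝ) < N := hk2.trans_le (mul_le_of_le_one_left hN0.le hFt1)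
      exact_mod_cast this
    have hqk := hq k ⟨hk0, hkN⟩
    have hqi := abs_lt.1 (hi k (Finset.mem_range.2 hkN))
    have hlt : q k < t := (monotone_cdf F).reflect_lt (by rwa [hqk, div_lt_iff₀ hN0])
    have hle := monotone_cdf (p i) hlt.le
    have hstep : cdf F t ≤ k / N + 1 / N := by rwa [← add_div, le_div_iff₀ hN0]
    linarith [hqi.1]
  · rcases lt_or_ge (1 - ε) (cdf F t) with hlt | hge
    · linarith
    obtain ⟨k, hk⟩ : ∃ k, k = ⌊cdf F t * N⌋₊ + 1 := ⟨_, rfl⟩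
    have hk1 : (k : ℝ) ≤ cdf F t * N + 1 := by
      rw [hk]
      push_cast
      linarith [Nat.floor_le (show 0 ≤ cdf F t * N by positivity)]
    have hk2 : cdf F t * N < k := by
      rw [hk]
      exact_mod_cast Nat.lt_floor_add_one _
    have hkN : k < N := by
      have : (k : ℝ) < N := by nlinarith
      exact_mod_cast this
    have hqk := hq k ⟨by omega, hkN⟩
    have hqi := abs_lt.1 (hi k (Finset.mem_range.2 hkN))
    have hlt : t < q k := (monotone_cdf F).reflect_lt (by rwa [hqk, lt_div_iff₀ hN0])
    have hle := monotone_cdf (p i) hlt.le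
    have hstep : (k : ℝ) / N ≤ cdf F t + 1 / N := by
      rw [div_le_iff₀ hN0, add_mul, one_div_mul_cancel hN0.ne']
      exact hk1
    linarith [hqi.2]

/-- Convergence of distribution functions on a dense set to a continuous distribution function
implies convergence everywhere. -/
lemma tendsto_cdf_of_dense {F : Measure ℝ} (hF : Continuous (cdf F)) {ι : Type*} {l : Filter ι}
    {p : ι → Measure ℝ} {D : Set ℝ} (hD : Dense D)
    (h : ∀ t ∈ D, Tendsto (fun i => cdf (p i) t) l (𝓝 (cdf F t))) (t : ℝ) :
    Tendsto (fun i => cdf (p i) t) l (𝓝 (cdf F t)) := by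
  refine tendsto_order.2 ⟨fun b hb => ?_, fun b hb => ?_⟩
  · obtain ⟨c, hc, hcb⟩ := exists_Ioc_subset_of_mem_nhds (hF.continuousAt.eventually_const_lt hb)
      (exists_lt t)
    obtain ⟨u, hu, hcu, hut⟩ := hD.exists_between hc
    filter_upwards [(h u hu).eventually_const_lt (hcb ⟨hcu, hut.le⟩)] with i hi
    exact hi.trans_le (monotone_cdf _ hut.le)
  · obtain ⟨c, hc, hcb⟩ := exists_Ico_subset_of_mem_nhds (hF.continuousAt.eventually_lt_const hb)
      (exists_gt t)
    obtain ⟨u, hu, htu, huc⟩ := hD.exists_between hc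
    filter_upwards [(h u hu).eventually_lt_const (hcb ⟨htu.le, huc⟩)] with i hi
    exact (monotone_cdf _ htu.le).trans_lt hi

/-! ### The Cramér-von Mises distance along converging distribution functions. -/

lemma sq_cdf_sub_cdf_le_one (F G : Measure ℝ) (t : ℝ) : (cdf F t - cdf G t) ^ 2 ≤ 1 := by
  rw [sq_le_one_iff_abs_le_one, abs_le]
  constructor <;> linarith [cdf_nonneg F t, cdf_le_one F t, cdf_nonneg G t, cdf_le_one G t]

lemma measurable_sq_cdf_sub_cdf (F G : Measure ℝ) :
    Measurable fun t => (cdf F t - cdf G t) ^ 2 :=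
  ((monotone_cdf F).measurable.sub (monotone_cdf G).measurable).pow_const 2

lemma integrable_sq_cdf_sub_cdf (F G : Measure ℝ) [IsFiniteMeasure G] :
    Integrable (fun t => (cdf F t - cdf G t) ^ 2) G :=
  Integrable.of_bound (measurable_sq_cdf_sub_cdf F G).aestronglyMeasurable 1
    (ae_of_all _ fun t => by
      rw [Real.norm_of_nonneg (sq_nonneg _)]
      exact sq_cdf_sub_cdf_le_one F G t)

lemma cvmDist_nonneg (F G : Measure ℝ) : 0 ≤ cvmDist F G :=
  integral_nonneg fun _ => sq_nonneg _

lemma cvmDist_le {F G : Measure ℝ} [IsProbabilityMeasure G] {c : ℝ}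
    (h : ∀ t, (cdf F t - cdf G t) ^ 2 ≤ c) : cvmDist F G ≤ c := by
  have := integral_mono (integrable_sq_cdf_sub_cdf F G) (integrable_const c) h
  simpa [cvmDist] using this

lemma le_cvmDist {F G : Measure ℝ} [IsProbabilityMeasure G] {s t c : ℝ} (hst : s ≤ t)
    (hc : 0 ≤ c) (h : ∀ u ∈ Set.Ioc s t, c ≤ |cdf F u - cdf G u|) :
    c ^ 2 * (cdf G t - cdf G s) ≤ cvmDist F G := by
  have hmass : G.real (Set.Ioc s t) = cdf G t - cdf G s := by
    rw [cdf_eq_real, cdf_eq_real, ← Set.Iic_sdiff_Iic,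
      measureReal_sdiff (Set.Iic_subset_Iic.2 hst) measurableSet_Iic]
  rw [← hmass]
  calc c ^ 2 * G.real (Set.Ioc s t) = ∫ _ in Set.Ioc s t, c ^ 2 ∂G := by
        rw [setIntegral_const, smul_eq_mul, mul_comm]
    _ ≤ ∫ u in Set.Ioc s t, (cdf F u - cdf G u) ^ 2 ∂G := by
        refine setIntegral_mono_on (integrable_const _).integrableOn
          (integrable_sq_cdf_sub_cdf F G).integrableOn measurableSet_Ioc fun u hu => ?_
        rw [← sq_abs (cdf F u - cdf G u)]
        exact pow_le_pow_left₀ hc (h u hu) 2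
    _ ≤ cvmDist F G :=
        setIntegral_le_integral (integrable_sq_cdf_sub_cdf F G) (ae_of_all _ fun _ => sq_nonneg _)

variable {ι : Type*} {l : Filter ι} {F G : Measure ℝ} {p q : ι → Measure ℝ}
  [∀ i, IsProbabilityMeasure (q i)]

lemma tendsto_cvmDist_zero (hF : Continuous (cdf F))
    (hp : ∀ t, Tendsto (fun i => cdf (p i) t) l (𝓝 (cdf F t)))
    (hq : ∀ t, Tendsto (fun i => cdf (q i) t) l (𝓝 (cdf F t))) :
    Tendsto (fun i => cvmDist (p i) (q i)) l (𝓝 0) := by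
  have up := Metric.tendstoUniformly_iff.1 (tendstoUniformly_of_tendsto_cdf hF hp)
  have uq := Metric.tendstoUniformly_iff.1 (tendstoUniformly_of_tendsto_cdf hF hq)
  refine tendsto_order.2 ⟨fun b hb => .of_forall fun i => hb.trans_le (cvmDist_nonneg _ _),
    fun b hb => ?_⟩
  obtain ⟨ε, hε, hεb⟩ : ∃ ε > 0, ε ^ 2 < b :=
    ⟨√(b / 2), Real.sqrt_pos.2 (half_pos hb), by rw [Real.sq_sqrt (by positivity)]; linarith⟩
  filter_upwards [up (ε / 2) (half_pos hε), uq (ε / 2) (half_pos hε)] with i h1 h2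
  refine (cvmDist_le fun t => ?_).trans_lt hεb
  rw [← sq_abs]
  refine pow_le_pow_left₀ (abs_nonneg _) ?_ 2
  rw [← Real.dist_eq]
  linarith [dist_triangle_left (cdf (p i) t) (cdf (q i) t) (cdf F t), h1 t, h2 t]

/-- The integrating measure moves with `i`, but its mass on `(s, t]` tends to that of `G`, hence
eventually exceeds half of it. -/
lemma liminf_cvmDist_pos_of_eventually [l.NeBot] {c s t : ℝ} (hc : 0 < c) (hst : s ≤ t)
    (hG : cdf G s < cdf G t)
    (hq : ∀ t, Tendsto (fun i => cdf (q i) t) l (𝓝 (cdf G t)))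
    (h : ∀ᶠ i in l, ∀ u ∈ Set.Ioc s t, c ≤ |cdf (p i) u - cdf (q i) u|) :
    0 < liminf (fun i => cvmDist (p i) (q i)) l := by
  set m := (cdf G t - cdf G s) / 2
  have hm : 0 < m := half_pos (sub_pos.2 hG)
  have hev : ∀ᶠ i in l, m < cdf (q i) t - cdf (q i) s :=
    ((hq t).sub (hq s)).eventually_const_lt (half_lt_self (sub_pos.2 hG))
  refine lt_of_lt_of_le (show 0 < c ^ 2 * m by positivity) (le_liminf_of_le ?_ ?_)
  -- A real `liminf` is meaningful only with an upper bound, here `1`.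
  · exact (isBoundedUnder_of ⟨1, fun i =>
      cvmDist_le (sq_cdf_sub_cdf_le_one _ _)⟩).isCoboundedUnder_ge
  · filter_upwards [h, hev] with i h1 h2
    refine le_trans ?_ (le_cvmDist hst hc.le h1)
    gcongr

lemma liminf_cvmDist_pos [l.NeBot] [IsProbabilityMeasure F] [IsProbabilityMeasure G]
    (hG : Continuous (cdf G)) (hFG : F ≠ G)
    (hp : ∀ t, Tendsto (fun i => cdf (p i) t) l (𝓝 (cdf F t)))
    (hq : ∀ t, Tendsto (fun i => cdf (q i) t) l (𝓝 (cdf G t))) :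
    0 < liminf (fun i => cvmDist (p i) (q i)) l := by
  obtain ⟨t₀, ht₀⟩ : ∃ t, cdf F t ≠ cdf G t := by
    by_contra! h
    exact hFG (Measure.eq_of_cdf F G (StieltjesFunction.ext h))
  rcases ht₀.lt_or_gt with hlt | hgt
  -- With `cdf G s = d`, monotonicity on `(s, t₀]` bounds `q i` below by its value at `s` and `p i`
  -- above by its value at `t₀`. The limiting gap is `d - cdf F t₀`, so half of it survives
  -- eventually.
  · obtain ⟨d, hd1, hd2⟩ := exists_between hlt
    have hd0 := (cdf_nonneg F t₀).trans_lt hd1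
    obtain ⟨u, hu⟩ := ((tendsto_cdf_atBot G).eventually_lt_const hd0).exists
    obtain ⟨s, hs⟩ := mem_range_of_exists_le_of_exists_ge hG ⟨u, hu.le⟩ ⟨t₀, hd2.le⟩
    have hst : s < t₀ := (monotone_cdf G).reflect_lt (by rwa [hs])
    have hev : ∀ᶠ i in l, (d - cdf F t₀) / 2 < cdf (q i) s - cdf (p i) t₀ :=
      ((hq s).sub (hp t₀)).eventually_const_lt (by rw [hs]; linarith)
    refine liminf_cvmDist_pos_of_eventually (half_pos (sub_pos.2 hd1)) hst.le (by rwa [hs]) hq ?_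
    filter_upwards [hev] with i hi v hv
    rw [abs_sub_comm]
    refine le_trans ?_ (le_abs_self _)
    linarith [monotone_cdf (q i) hv.1.le, monotone_cdf (p i) hv.2]
  · obtain ⟨d, hd1, hd2⟩ := exists_between hgt
    have hd0 := hd2.trans_le (cdf_le_one F t₀)
    obtain ⟨u, hu⟩ := ((tendsto_cdf_atTop G).eventually_const_lt hd0).exists
    obtain ⟨s, hs⟩ := mem_range_of_exists_le_of_exists_ge hG ⟨t₀, hd1.le⟩ ⟨u, hu.le⟩
    have hst : t₀ < s := (monotone_cdf G).reflect_lt (by rwa [hs])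
    have hev : ∀ᶠ i in l, (cdf F t₀ - d) / 2 < cdf (p i) t₀ - cdf (q i) s :=
      ((hp t₀).sub (hq s)).eventually_const_lt (by rw [hs]; linarith)
    refine liminf_cvmDist_pos_of_eventually (half_pos (sub_pos.2 hd2)) hst.le (by rwa [hs]) hq ?_
    filter_upwards [hev] with i hi v hv
    refine le_trans ?_ (le_abs_self _)
    linarith [monotone_cdf (p i) hv.1.le, monotone_cdf (q i) hv.2]

/-- The distribution functions of the posterior converge almost surely, everywhere. -/
lemma IsDPPosterior.ae_tendsto_cdf {Ω : Type*} [MeasurableSpace Ω] {μ : Measure Ω}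
    [IsProbabilityMeasure μ] [IsProbabilityMeasure F] {H : Measure ℝ} [IsProbabilityMeasure H]
    (hF : Continuous (cdf F)) {a : ℝ} (ha : 0 < a) {X : ℕ → Ω → ℝ} (hX : IsIIDSample X F μ)
    {P : ℕ → Ω → ProbabilityMeasure ℝ} (hP : IsDPPosterior P a H X μ) :
    ∀ᵐ ω ∂μ, ∀ t, Tendsto (fun n => cdf (P n ω : Measure ℝ) t) atTop (𝓝 (cdf F t)) := by
  have h : ∀ᵐ ω ∂μ, ∀ r : ℚ, Tendsto (fun n => (P n ω : Measure ℝ).real (Set.Iic (r : ℝ))) atTop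
      (𝓝 (F.real (Set.Iic (r : ℝ)))) :=
    ae_all_iff.2 fun r => hP.ae_tendsto_real ha hX measurableSet_Iic
  filter_upwards [h] with ω hω
  refine tendsto_cdf_of_dense hF (Rat.denseRange_cast (𝕜 := ℝ)) ?_
  rintro _ ⟨r, rfl⟩
  simpa only [cdf_eq_real] using hω r

end CvMTest

theorem mainTheorem4 {Ω : Type*} [MeasurableSpace Ω] (μ : Measure Ω) [IsProbabilityMeasure μ]
    (F G H₁ H₂ : Measure ℝ) [IsProbabilityMeasure F] [IsProbabilityMeasure G]
    [IsProbabilityMeasure H₁] [IsProbabilityMeasure H₂]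
    (hF : Continuous (cdf F)) (hG : Continuous (cdf G))
    (a₁ a₂ : ℝ) (ha₁ : 0 < a₁) (ha₂ : 0 < a₂)
    (X Y : ℕ → Ω → ℝ) (hX : CvMTest.IsIIDSample X F μ) (hY : CvMTest.IsIIDSample Y G μ)
    (P Q : ℕ → Ω → ProbabilityMeasure ℝ)
    (hP : CvMTest.IsDPPosterior P a₁ H₁ X μ) (hQ : CvMTest.IsDPPosterior Q a₂ H₂ Y μ) :
    (F = G → ∀ᵐ ω ∂μ,
      Tendsto (fun n : ℕ × ℕ => CvMTest.cvmDist (P n.1 ω) (Q n.2 ω)) (atTop ×ˢ atTop) (𝓝 0)) ∧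
    (F ≠ G → ∀ᵐ ω ∂μ,
      0 < liminf (fun n : ℕ × ℕ => CvMTest.cvmDist (P n.1 ω) (Q n.2 ω)) (atTop ×ˢ atTop)) := by
  have h₁ := hP.ae_tendsto_cdf hF ha₁ hX
  have h₂ := hQ.ae_tendsto_cdf hG ha₂ hY
  constructor
  · rintro rfl
    filter_upwards [h₁, h₂] with ω hp hq
    exact CvMTest.tendsto_cvmDist_zero hF (fun t => (hp t).comp tendsto_fst)
      fun t => (hq t).comp tendsto_snd
  · intro hFG
    filter_upwards [h₁, h₂] with ω hp hq
    exact CvMTest.liminf_cvmDist_pos hG hFG (fun t => (hp t).comp tendsto_fst)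
      fun t => (hq t).comp tendsto_snd
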